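/- Let $N\ge 1$, let $X$ be a metrizable space, and let $(\Phi(t))_{t\ge 0}$ be a continuous semiflow on $X$, i.e. $\Phi(0)=\mathrm{id}$, $\Phi(t_1+t_2)=\Phi(t_1)\circ\Phi(t_2)$, and $(t,u)\mapsto\Phi(t)u$ is continuous on $[0,\infty)\times X$. Assume that it is an *extended dissipative system* on $\mathbb{R}^N$: to each $u\in X$ are associated continuous functions $e,d:\mathbb{R}^N\to[0,\infty)$ and $f:\mathbb{R}^N\to\mathbb{R}^N$ such that - $e,f,d$ depend continuously on $u\in X$, uniformly on compact subsets of $\mathbb{R}^N$; - $|f|^2\le b(e)\,d$ for some nondecreasing function $b:[0,\infty)\to[0,\infty)$ independent of $u$; - $d\equiv 0$ only if $\Phi(t)u=u$ for all $t\ge 0$; - along every trajectory $u(t)=\Phi(t)u_0$, the corresponding functions $e(x,t),f(x,t),d(x,t)$ satisfy $\partial_t e=\operatorname{div}_x f-d$ in the sense of distributions on $\mathbb{R}^N\times(0,\infty)$. Let $u(t)=\Phi(t)u_0$ be a trajectory such that $$e_0=\sup_{x\in\mathbb{R}^N}e(x,0)<\infty,\qquad \beta=\sup_{x\in\mathbb{R}^N}\sup_{t\ge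 0}b(e(x,t))<\infty,$$ and, if $N\ge 2$, assume moreover that $e_0>0$ and $\beta>0$. Let $B_R=\{x\in\mathbb{R}^N : |x|<R\}$ and $\omega_N=2\pi^{N/2}/\Gamma(N/2)$. Then for every $R>0$: 1. if $N=1$, $\displaystyle\limsup_{T\to\infty}\frac{1}{\sqrt T}\int_0^T\!\!\int_{B_R}d(x,t)\,dx\,dt\le 2\sqrt{\beta e_0}$; 2. if $N=2$, $\displaystyle\limsup_{T\to\infty}\frac{\log T}{T}\int_0^T\!\!\int_{B_R}d(x,t)\,dx\,dt\le 4\pi\beta$; 3. if $N\ge 3$, $\displaystyle\limsup_{T\to\infty}\frac{1}{T}\int_0^T\!\!\int_{B_R}d(x,t)\,dx\,dt\le \beta(N-2)\,\omega_N R^{N-2}$. -/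

import Mathlib

open Filter Topology MeasureTheory
open scoped NNReal ContDiff

/-- The energy balance `∂ₜ e = div f - d` in the sense of distributions on `ℝᴺ × (0, ∞)`:
`∫∫ e ∂ₜφ = ∫∫ (f · ∇ₓφ + d φ)` for every smooth `φ` compactly supported in `ℝᴺ × (0, ∞)`.
The derivative of `φ` in the direction `(0, 1)` is `∂ₜφ`, and its derivative in the direction
`(v, 0)` is `v · ∇ₓφ`. -/
def IsDistributionalEnergyBalance {N : ℕ}
    (e : EuclideanSpace ℝ (Fin N) → ℝ → ℝ)
    (f : EuclideanSpace ℝ (Fin N) → ℝ → EuclideanSpace ℝ (Fin N))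
    (d : EuclideanSpace ℝ (Fin N) → ℝ → ℝ) : Prop :=
  ∀ φ : EuclideanSpace ℝ (Fin N) × ℝ → ℝ,
    ContDiff ℝ ∞ φ → HasCompactSupport φ → tsupport φ ⊆ {p | 0 < p.2} →
      ∫ p, e p.1 p.2 * fderiv ℝ φ p (0, 1) =
        ∫ p, (fderiv ℝ φ p (f p.1 p.2, 0) + d p.1 p.2 * φ p)

/-- An extended dissipative system on `ℝᴺ` with state space `X`: a continuous semiflow on `X`
together with an energy density `e`, a (backward) energy flux `f` and an energy dissipation rate
`d` attached to every state. Spaces of continuous maps carry the compact-open topology, i.e. the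
topology of uniform convergence on compact sets. -/
structure ExtendedDissipativeSystem (N : ℕ) (X : Type*) [TopologicalSpace X] where
  /-- the continuous semiflow `Φ` -/
  Φ : Flow ℝ≥0 X
  /-- the energy density -/
  e : X → C(EuclideanSpace ℝ (Fin N), ℝ)
  /-- the (backward) energy flux -/
  f : X → C(EuclideanSpace ℝ (Fin N), EuclideanSpace ℝ (Fin N))
  /-- the energy dissipation rate -/
  d : X → C(EuclideanSpace ℝ (Fin N), ℝ)
  /-- the function that controls the flux; only its values on `[0, ∞)` matter -/
  b : ℝ → ℝ
  e_nonneg : ∀ u x, 0 ≤ e u x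
  d_nonneg : ∀ u x, 0 ≤ d u x
  continuous_e : Continuous e
  continuous_f : Continuous f
  continuous_d : Continuous d
  b_nonneg : ∀ s, 0 ≤ s → 0 ≤ b s
  b_mono : MonotoneOn b (Set.Ici 0)
  flux_bound : ∀ u x, ‖f u x‖ ^ 2 ≤ b (e u x) * d u x
  equilibrium_of_d_eq_zero : ∀ u, (∀ x, d u x = 0) → ∀ t, Φ t u = u
  energy_balance : ∀ u₀, IsDistributionalEnergyBalance
    (fun x t => e (Φ t.toNNReal u₀) x)
    (fun x t => f (Φ t.toNNReal u₀) x)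
    (fun x t => d (Φ t.toNNReal u₀) x)

/-- The energy `∫₀ᵀ ∫_{|x| < R} d(x, t) dx dt` dissipated in the ball `B_R` over the time interval
`[0, T]` along the trajectory that starts at `u₀`. -/
noncomputable def ExtendedDissipativeSystem.dissipatedEnergy {N : ℕ} {X : Type*}
    [TopologicalSpace X] (S : ExtendedDissipativeSystem N X) (u₀ : X) (R T : ℝ) : ℝ :=
  ∫ t in (0 : ℝ)..T, ∫ x in Metric.ball (0 : EuclideanSpace ℝ (Fin N)) R,
    S.d (S.Φ t.toNNReal u₀) x

/-- The area `ω_N = 2 π^{N/2} / Γ(N/2)` of the unit sphere in `ℝᴺ`. -/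
noncomputable def sphereArea (N : ℕ) : ℝ :=
  2 * Real.pi ^ ((N : ℝ) / 2) / Real.Gamma ((N : ℝ) / 2)

/-! Test the energy balance with `χ ^ 2`, where `χ` is a cutoff equal to 1 on `B_R`. The flux enters
through `2 χ ∇χ · f`, and `|f|² ≤ β d` with Young's inequality bounds it below by `-(d χ² + β
|∇χ|²)`. Outside `B_R` the dissipation absorbs the flux; inside, `∇χ = 0` and all of `d` survives.
Since the final energy is nonnegative, the energy dissipated in `B_R` up to time `T` is at most `e₀
∫ χ² + β T ∫ |∇χ|²` (`dissipatedEnergy_le_of_cutoff`).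

It remains to choose `χ` radial, according to `T`. For `N = 1` both terms matter: a profile decaying
like `exp (-c (r - R))` with `c` of order `1 / √T` balances them. For `N ≥ 2` the gradient term
dominates, so `χ` is the capacitary potential of `B_R` in `B_L`, whose Dirichlet integral is `ω_N /
(P L - P R)` with `P' = r ^ (1 - N)` (`dissipatedEnergy_le_of_primitive`). For `N = 2`, `L` is taken
slightly below `√T`, so that the capacity is about `4π / log T`; for `N ≥ 3`, `T → ∞` with `L` fixed
and then `L → ∞`, which leaves the capacity of `B_R` in the whole space.

Two technical points: the distributional balance is turned into an identity on `[0, T]` by the du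
Bois-Reymond lemma (`IsDistributionalEnergyBalance.integral_eq`), and profiles with corners are
smoothed at the cost of a factor `K ^ 2` with `K → 1` (`exists_radial_cutoff`). -/

open scoped Convolution

/-! ### Smooth primitives and the du Bois-Reymond lemma -/

theorem hasDerivAt_intervalIntegral_zero {g : ℝ → ℝ} (hg : Continuous g) (s : ℝ) :
    HasDerivAt (fun s => ∫ u in (0 : ℝ)..s, g u) (g s) s :=
  intervalIntegral.integral_hasDerivAt_right (hg.intervalIntegrable _ _)
    (hg.stronglyMeasurableAtFilter _ _) hg.continuousAt

theorem contDiff_intervalIntegral_zero {g : ℝ → ℝ} (hg : ContDiff ℝ ∞ g) :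
    ContDiff ℝ ∞ (fun s => ∫ u in (0 : ℝ)..s, g u) := by
  rw [contDiff_infty_iff_deriv]
  refine ⟨fun s => (hasDerivAt_intervalIntegral_zero hg.continuous s).differentiableAt, ?_⟩
  have : deriv (fun s => ∫ u in (0 : ℝ)..s, g u) = g :=
    funext fun s => (hasDerivAt_intervalIntegral_zero hg.continuous s).deriv
  rwa [this]

/-- The primitive of a function supported in `[m, M]`, `0 ≤ m`, vanishes to the left of `m` and is
the total integral to the right of `M`. -/
theorem intervalIntegral_zero_of_le {g : ℝ → ℝ} {m s : ℝ} (hm : 0 ≤ m)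
    (hg : ∀ u ≤ m, g u = 0) (hs : s ≤ m) : ∫ u in (0 : ℝ)..s, g u = 0 := by
  apply intervalIntegral.integral_zero_ae
  refine Eventually.of_forall fun u hu => hg u ?_
  rw [Set.mem_uIoc] at hu
  rcases hu with hu | hu <;> linarith [hu.1, hu.2]

theorem intervalIntegral_eq_integral_of_le {g : ℝ → ℝ} {M s : ℝ} (hM : 0 ≤ M)
    (hg0 : ∀ u ≤ 0, g u = 0) (hg : ∀ u, M ≤ u → g u = 0) (hs : M ≤ s) :
    ∫ u in (0 : ℝ)..s, g u = ∫ u, g u := by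
  rw [intervalIntegral.integral_of_le (hM.trans hs)]
  refine setIntegral_eq_integral_of_forall_compl_eq_zero fun u hu => ?_
  simp only [Set.mem_Ioc, not_and_or, not_lt, not_le] at hu
  rcases hu with hu | hu
  · exact hg0 u hu
  · exact hg u (by linarith)

theorem ContDiffBump.normed_sub_eq_zero {φ : ContDiffBump (0 : ℝ)} {a u : ℝ}
    (h : φ.rOut ≤ |a - u|) : φ.normed volume (a - u) = 0 := by
  have : a - u ∉ Function.support (φ.normed volume) := by
    rw [φ.support_normed_eq]
    simpa using h
  simpa using this

/-- The test function is the primitive of the difference of two mollifiers centred at `a` and `b`.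
Their masses cancel, so this primitive has compact support, and the hypothesis says that the
mollified values of `F` at `a` and `b` agree. -/
theorem eq_of_integral_mul_deriv_eq_zero {F : ℝ → ℝ} (hF : Continuous F)
    (h : ∀ θ : ℝ → ℝ, ContDiff ℝ ∞ θ → HasCompactSupport θ → tsupport θ ⊆ Set.Ioi 0 →
      ∫ t, F t * deriv θ t = 0) {a b : ℝ} (ha : 0 < a) (hb : 0 < b) : F a = F b := by
  -- Bumps of radius at most `m` around `a` and `b` vanish on `(-∞, m]`, which keeps the support of
  -- the primitive inside `(0, ∞)`.
  set m := min a b / 2 with hm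
  have hm0 : 0 < m := by positivity
  have hma : 2 * m ≤ a := by have := min_le_left a b; linarith
  have hmb : 2 * m ≤ b := by have := min_le_right a b; linarith
  let φ : ℕ → ContDiffBump (0 : ℝ) := fun n =>
    { rIn := m / (n + 1) / 2
      rOut := m / (n + 1)
      rIn_pos := by positivity
      rIn_lt_rOut := half_lt_self (by positivity) }
  have hφm : ∀ n, (φ n).rOut ≤ m := fun n => by
    change m / (n + 1) ≤ m
    apply div_le_self hm0.le
    have : (0 : ℝ) ≤ n := n.cast_nonneg
    linarith
  have hlim : Tendsto (fun n => (φ n).rOut) atTop (𝓝 0) :=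
    tendsto_const_div_atTop_nhds_zero_nat m |>.comp (tendsto_add_atTop_nat 1) |>.congr
      fun n => by simp [φ]
  have conv : ∀ n c, ((φ n).normed volume ⋆[ContinuousLinearMap.lsmul ℝ ℝ, volume] F) c
      = ∫ t, F t * (φ n).normed volume (c - t) := fun n c => by
    rw [convolution_eq_swap]
    simp [mul_comm]
  have key : ∀ n, ((φ n).normed volume ⋆[ContinuousLinearMap.lsmul ℝ ℝ, volume] F) a
      = ((φ n).normed volume ⋆[ContinuousLinearMap.lsmul ℝ ℝ, volume] F) b := fun n => by
    set ρ := (φ n).normed volume with hρ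
    have hρc : ContDiff ℝ ∞ ρ := (φ n).contDiff_normed
    let g : ℝ → ℝ := fun u => ρ (a - u) - ρ (b - u)
    have hg : ContDiff ℝ ∞ g := by fun_prop
    have hleft : ∀ u ≤ m, g u = 0 := fun u hu => by
      have h1 : ρ (a - u) = 0 := ContDiffBump.normed_sub_eq_zero
        ((hφm n).trans ((by linarith : m ≤ a - u).trans (le_abs_self _)))
      have h2 : ρ (b - u) = 0 := ContDiffBump.normed_sub_eq_zero
        ((hφm n).trans ((by linarith : m ≤ b - u).trans (le_abs_self _)))
      simp [g, h1, h2]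
    have hright : ∀ u, a + b ≤ u → g u = 0 := fun u hu => by
      have h1 : ρ (a - u) = 0 := ContDiffBump.normed_sub_eq_zero
        ((hφm n).trans ((by linarith : m ≤ -(a - u)).trans (neg_le_abs _)))
      have h2 : ρ (b - u) = 0 := ContDiffBump.normed_sub_eq_zero
        ((hφm n).trans ((by linarith : m ≤ -(b - u)).trans (neg_le_abs _)))
      simp [g, h1, h2]
    have hint : ∀ c, Integrable fun u => ρ (c - u) := fun c =>
      (φ n).integrable_normed.comp_sub_left c
    have hg0 : ∫ u, g u = 0 := by
      simp only [g]
      rw [integral_sub (hint a) (hint b), integral_sub_left_eq_self, integral_sub_left_eq_self,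
        sub_self]
    have hsupp : tsupport (fun s => ∫ u in (0 : ℝ)..s, g u) ⊆ Set.Icc m (a + b) := by
      refine closure_minimal (fun s hs => ?_) isClosed_Icc
      by_contra hcon
      apply hs
      simp only [Set.mem_Icc, not_and_or, not_le] at hcon
      rcases hcon with hcon | hcon
      · exact intervalIntegral_zero_of_le hm0.le hleft hcon.le
      · simp only
        rw [intervalIntegral_eq_integral_of_le (by positivity)
          (fun u hu => hleft u (hu.trans hm0.le)) hright hcon.le, hg0]
    have := h (fun s => ∫ u in (0 : ℝ)..s, g u) (contDiff_intervalIntegral_zero hg)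
      (isCompact_Icc.of_isClosed_subset (isClosed_tsupport _) hsupp)
      (hsupp.trans fun s hs => hm0.trans_le hs.1)
    simp only [(hasDerivAt_intervalIntegral_zero hg.continuous _).deriv] at this
    rw [conv, conv, ← sub_eq_zero, ← integral_sub]
    · refine Eq.trans (integral_congr_ae (Eventually.of_forall fun t => ?_)) this
      simp only [g, hρ]
      ring
    · exact (hF.mul ((φ n).continuous_normed.comp (by fun_prop))).integrable_of_hasCompactSupport
        (((φ n).hasCompactSupport_normed.comp_homeomorph (Homeomorph.subLeft a)).mul_left)
    · exact (hF.mul ((φ n).continuous_normed.comp (by fun_prop))).integrable_of_hasCompactSupport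
        (((φ n).hasCompactSupport_normed.comp_homeomorph (Homeomorph.subLeft b)).mul_left)
  have hA := ContDiffBump.convolution_tendsto_right_of_continuous (μ := volume) hlim hF a
  have hB := ContDiffBump.convolution_tendsto_right_of_continuous (μ := volume) hlim hF b
  exact tendsto_nhds_unique hA (hB.congr fun n => (key n).symm)

/-! ### A smooth step function of slope close to one -/

/-- Integrate a normalized bump centred at `1 / 2` with outer radius `1 / 2`. Its height is at most
the inverse length of its inner ball, which is `K` for the inner radius `1 / (2 * K)`. -/
theorem exists_smooth_step {K : ℝ} (hK : 1 < K) :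
    ∃ η : ℝ → ℝ, ContDiff ℝ ∞ η ∧ (∀ s ≤ 0, η s = 0) ∧ (∀ s, 1 ≤ s → η s = 1) ∧
      (∀ s, 0 ≤ deriv η s) ∧ ∀ s, deriv η s ≤ K := by
  let φ : ContDiffBump (0 : ℝ) :=
    { rIn := 1 / (2 * K)
      rOut := 1 / 2
      rIn_pos := by positivity
      rIn_lt_rOut := by gcongr; linarith }
  set g : ℝ → ℝ := fun u => φ.normed volume (1 / 2 - u) with hgdef
  have hg : ContDiff ℝ ∞ g := φ.contDiff_normed.comp (by fun_prop)
  have hleft : ∀ u ≤ 0, g u = 0 := fun u hu => ContDiffBump.normed_sub_eq_zero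
    ((by linarith : (1 / 2 : ℝ) ≤ 1 / 2 - u).trans (le_abs_self _))
  have hright : ∀ u, 1 ≤ u → g u = 0 := fun u hu => ContDiffBump.normed_sub_eq_zero
    ((by linarith : (1 / 2 : ℝ) ≤ -(1 / 2 - u)).trans (neg_le_abs _))
  have hd : ∀ s, deriv (fun s => ∫ u in (0 : ℝ)..s, g u) s = g s := fun s =>
    (hasDerivAt_intervalIntegral_zero hg.continuous s).deriv
  refine ⟨fun s => ∫ u in (0 : ℝ)..s, g u, contDiff_intervalIntegral_zero hg,
    fun s hs => intervalIntegral_zero_of_le le_rfl hleft hs, fun s hs => ?_, fun s => ?_,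
    fun s => ?_⟩
  · simp only
    rw [intervalIntegral_eq_integral_of_le zero_le_one hleft hright hs, hgdef,
      integral_sub_left_eq_self, φ.integral_normed]
  · rw [hd]
    exact φ.nonneg_normed _
  · rw [hd]
    refine (φ.normed_le_div_measure_closedBall_rIn volume _).trans_eq ?_
    rw [Real.volume_real_closedBall (by positivity)]
    change 1 / (2 * (1 / (2 * K))) = K
    field_simp

/-! ### The localized energy identity -/

section EnergyIdentity

variable {N : ℕ}

theorem continuous_integral_of_eq_zero_off_compact {E : Type*} [NormedAddCommGroup E]
    [MeasurableSpace E] [BorelSpace E] [SecondCountableTopology E] {μ : Measure E}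
    [IsLocallyFiniteMeasure μ] {k : E → ℝ → ℝ}
    (hk : Continuous fun p : E × ℝ => k p.1 p.2) {s : Set E} (hs : IsCompact s)
    (h0 : ∀ t, ∀ x ∉ s, k x t = 0) : Continuous fun t => ∫ x, k x t ∂μ := by
  have : (fun t => ∫ x, k x t ∂μ) = fun t => ∫ x in s, k x t ∂μ := funext fun t =>
    (setIntegral_eq_integral_of_forall_compl_eq_zero (h0 t)).symm
  rw [this]
  exact continuous_parametric_integral_of_continuous (f := fun t x => k x t)
    (hk.comp continuous_swap) hs

theorem fderiv_mul_fst_snd {E : Type*} [NormedAddCommGroup E] [NormedSpace ℝ E]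
    {ψ : E → ℝ} {θ : ℝ → ℝ} (hψ : Differentiable ℝ ψ) (hθ : Differentiable ℝ θ) (p : E × ℝ)
    (v : E) (s : ℝ) :
    fderiv ℝ (fun p : E × ℝ => ψ p.1 * θ p.2) p (v, s) =
      fderiv ℝ ψ p.1 v * θ p.2 + ψ p.1 * (deriv θ p.2 * s) := by
  have h1 : HasFDerivAt (fun p : E × ℝ => ψ p.1)
      ((fderiv ℝ ψ p.1).comp (ContinuousLinearMap.fst ℝ E ℝ)) p :=
    (hψ p.1).hasFDerivAt.comp p hasFDerivAt_fst
  have h2 : HasFDerivAt (fun p : E × ℝ => θ p.2)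
      ((fderiv ℝ θ p.2).comp (ContinuousLinearMap.snd ℝ E ℝ)) p :=
    (hθ p.2).hasFDerivAt.comp p hasFDerivAt_snd
  have h3 : fderiv ℝ θ p.2 s = deriv θ p.2 * s := by
    rw [fderiv_eq_smul_deriv, smul_eq_mul, mul_comm]
  have h4 : fderiv ℝ (fun p : E × ℝ => ψ p.1 * θ p.2) p = _ := (h1.mul h2).fderiv
  rw [h4]
  simp [h3]
  ring

/-- Product test functions `ψ(x) θ(t)` and Fubini reduce the balance to a weak differential equation
in time. -/
theorem IsDistributionalEnergyBalance.integral_mul_deriv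
    {e : EuclideanSpace ℝ (Fin N) → ℝ → ℝ}
    {f : EuclideanSpace ℝ (Fin N) → ℝ → EuclideanSpace ℝ (Fin N)}
    {d : EuclideanSpace ℝ (Fin N) → ℝ → ℝ}
    (h : IsDistributionalEnergyBalance e f d)
    (he : Continuous fun p : EuclideanSpace ℝ (Fin N) × ℝ => e p.1 p.2)
    (hf : Continuous fun p : EuclideanSpace ℝ (Fin N) × ℝ => f p.1 p.2)
    (hd : Continuous fun p : EuclideanSpace ℝ (Fin N) × ℝ => d p.1 p.2)
    {ψ : EuclideanSpace ℝ (Fin N) → ℝ} (hψ : ContDiff ℝ ∞ ψ) (hψs : HasCompactSupport ψ)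
    {θ : ℝ → ℝ} (hθ : ContDiff ℝ ∞ θ) (hθs : HasCompactSupport θ)
    (hθ0 : tsupport θ ⊆ Set.Ioi 0) :
    ∫ t, (∫ x, e x t * ψ x) * deriv θ t =
      ∫ t, (∫ x, (fderiv ℝ ψ x (f x t) + d x t * ψ x)) * θ t := by
  have hθd : Continuous (deriv θ) := hθ.continuous_deriv (by simp)
  have hψd : Continuous (fderiv ℝ ψ) := hψ.continuous_fderiv (by simp)
  have hψf : Continuous fun p : EuclideanSpace ℝ (Fin N) × ℝ => fderiv ℝ ψ p.1 (f p.1 p.2) :=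
    (hψd.comp continuous_fst).clm_apply hf
  have hφs : ∀ p : EuclideanSpace ℝ (Fin N) × ℝ, p ∉ tsupport ψ ×ˢ tsupport θ →
      ψ p.1 * θ p.2 = 0 := fun p hp => by
    rw [Set.mem_prod, not_and_or] at hp
    rcases hp with hp | hp
    · rw [image_eq_zero_of_notMem_tsupport hp, zero_mul]
    · rw [image_eq_zero_of_notMem_tsupport hp, mul_zero]
  have hK : IsCompact (tsupport ψ ×ˢ tsupport θ) := hψs.prod hθs
  have hts : tsupport (fun p : EuclideanSpace ℝ (Fin N) × ℝ => ψ p.1 * θ p.2) ⊆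
      tsupport ψ ×ˢ tsupport θ :=
    closure_minimal (fun p hp => by by_contra hc; exact hp (hφs p hc)) hK.isClosed
  have key := h (fun p => ψ p.1 * θ p.2) (by fun_prop) (.intro hK hφs)
    (hts.trans fun p hp => hθ0 hp.2)
  simp only [fderiv_mul_fst_snd (hψ.differentiable (by simp))
    (hθ.differentiable (by simp)), map_zero, zero_mul, mul_one, mul_zero, zero_add,
    add_zero] at key
  have hi1 : Integrable fun p : EuclideanSpace ℝ (Fin N) × ℝ =>
      e p.1 p.2 * (ψ p.1 * deriv θ p.2) := by
    refine Continuous.integrable_of_hasCompactSupport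
      (he.mul ((hψ.continuous.comp continuous_fst).mul (hθd.comp continuous_snd)))
      (.intro hK fun p hp => ?_)
    rw [Set.mem_prod, not_and_or] at hp
    rcases hp with hp | hp
    · rw [image_eq_zero_of_notMem_tsupport hp, zero_mul, mul_zero]
    · rw [image_eq_zero_of_notMem_tsupport (fun h => hp (tsupport_deriv_subset h)), mul_zero,
        mul_zero]
  have hi2 : Integrable fun p : EuclideanSpace ℝ (Fin N) × ℝ =>
      fderiv ℝ ψ p.1 (f p.1 p.2) * θ p.2 + d p.1 p.2 * (ψ p.1 * θ p.2) := by
    refine Continuous.integrable_of_hasCompactSupport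
      ((hψf.mul (hθ.continuous.comp continuous_snd)).add
        (hd.mul ((hψ.continuous.comp continuous_fst).mul (hθ.continuous.comp continuous_snd))))
      (.intro hK fun p hp => ?_)
    rw [Set.mem_prod, not_and_or] at hp
    rcases hp with hp | hp
    · rw [image_eq_zero_of_notMem_tsupport hp,
        image_eq_zero_of_notMem_tsupport (fun h => hp (tsupport_fderiv_subset ℝ h))]
      simp
    · rw [image_eq_zero_of_notMem_tsupport hp]
      simp
  rw [Measure.volume_eq_prod] at key hi1 hi2
  rw [integral_prod_symm _ hi1, integral_prod_symm _ hi2] at key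
  calc _ = ∫ t, ∫ x, e x t * (ψ x * deriv θ t) := by
        refine integral_congr_ae (Eventually.of_forall fun t => ?_)
        simp only
        rw [← integral_mul_const]
        simp only [mul_assoc]
    _ = _ := key
    _ = _ := by
        refine integral_congr_ae (Eventually.of_forall fun t => ?_)
        simp only
        rw [← integral_mul_const]
        simp only [add_mul, mul_assoc]

/-- The energy balance tested against a function of the space variable only. -/
theorem IsDistributionalEnergyBalance.integral_eq
    {e : EuclideanSpace ℝ (Fin N) → ℝ → ℝ}
    {f : EuclideanSpace ℝ (Fin N) → ℝ → EuclideanSpace ℝ (Fin N)}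
    {d : EuclideanSpace ℝ (Fin N) → ℝ → ℝ}
    (h : IsDistributionalEnergyBalance e f d)
    (he : Continuous fun p : EuclideanSpace ℝ (Fin N) × ℝ => e p.1 p.2)
    (hf : Continuous fun p : EuclideanSpace ℝ (Fin N) × ℝ => f p.1 p.2)
    (hd : Continuous fun p : EuclideanSpace ℝ (Fin N) × ℝ => d p.1 p.2)
    {ψ : EuclideanSpace ℝ (Fin N) → ℝ} (hψ : ContDiff ℝ ∞ ψ) (hψs : HasCompactSupport ψ)
    {T : ℝ} (hT : 0 < T) :
    (∫ x, e x T * ψ x) + ∫ t in (0 : ℝ)..T, ∫ x, (fderiv ℝ ψ x (f x t) + d x t * ψ x) =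
      ∫ x, e x 0 * ψ x := by
  have hψd : Continuous (fderiv ℝ ψ) := hψ.continuous_fderiv (by simp)
  have hE : Continuous fun t => ∫ x, e x t * ψ x :=
    continuous_integral_of_eq_zero_off_compact (he.mul (hψ.continuous.comp continuous_fst)) hψs
      fun t x hx => by rw [image_eq_zero_of_notMem_tsupport hx, mul_zero]
  have hH : Continuous fun t => ∫ x, (fderiv ℝ ψ x (f x t) + d x t * ψ x) :=
    continuous_integral_of_eq_zero_off_compact
      (((hψd.comp continuous_fst).clm_apply hf).add (hd.mul (hψ.continuous.comp continuous_fst)))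
      hψs fun t x hx => by
        rw [image_eq_zero_of_notMem_tsupport hx,
          image_eq_zero_of_notMem_tsupport (fun h => hx (tsupport_fderiv_subset ℝ h))]
        simp
  set E := fun t => ∫ x, e x t * ψ x with hEdef
  set H := fun t => ∫ x, (fderiv ℝ ψ x (f x t) + d x t * ψ x) with hHdef
  have hP : ∀ t, HasDerivAt (fun t => ∫ u in (0 : ℝ)..t, H u) (H t) t :=
    hasDerivAt_intervalIntegral_zero hH
  have hPc : Continuous fun t => ∫ u in (0 : ℝ)..t, H u :=
    continuous_iff_continuousAt.2 fun t => (hP t).continuousAt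
  have hF : Continuous fun t => E t + ∫ u in (0 : ℝ)..t, H u := hE.add hPc
  -- The weak equation reads `E' = -H`; integrating the primitive of `H` by parts shows that this
  -- sum has zero weak derivative.
  have hconst : ∀ a > 0, E a + ∫ u in (0 : ℝ)..a, H u = E T + ∫ u in (0 : ℝ)..T, H u := by
    intro a ha
    refine eq_of_integral_mul_deriv_eq_zero hF (fun θ hθ hθs hθ0 => ?_) ha hT
    have hθd : Continuous (deriv θ) := hθ.continuous_deriv (by simp)
    have h1 := h.integral_mul_deriv he hf hd hψ hψs hθ hθs hθ0
    have h2 := integral_mul_deriv_eq_deriv_mul_of_integrable (u := fun t => ∫ u in (0 : ℝ)..t, H u)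
      (v := θ) (u' := H) (v' := deriv θ) (fun t _ => hP t)
      (fun t _ => (hθ.differentiable (by simp) t).hasDerivAt)
      ((hPc.mul hθd).integrable_of_hasCompactSupport hθs.deriv.mul_left)
      ((hH.mul hθ.continuous).integrable_of_hasCompactSupport hθs.mul_left)
      ((hPc.mul hθ.continuous).integrable_of_hasCompactSupport hθs.mul_left)
    simp only [add_mul]
    have h3 : Integrable fun t => E t * deriv θ t :=
      (hE.mul hθd).integrable_of_hasCompactSupport hθs.deriv.mul_left
    have h4 : Integrable fun t => (∫ u in (0 : ℝ)..t, H u) * deriv θ t :=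
      (hPc.mul hθd).integrable_of_hasCompactSupport hθs.deriv.mul_left
    rw [integral_add h3 h4, h2, h1]
    simp [hHdef]
  -- Test functions vanish near `t = 0`, so the initial time is reached only through continuity.
  have hlim : Tendsto (fun t => E t + ∫ u in (0 : ℝ)..t, H u) (𝓝[>] 0) (𝓝 (E 0)) := by
    have := (hF.tendsto 0).mono_left (nhdsWithin_le_nhds (s := Set.Ioi 0))
    simpa using this
  refine tendsto_nhds_unique (tendsto_const_nhds.congr' ?_) hlim
  filter_upwards [self_mem_nhdsWithin] with a ha using (hconst a ha).symm

end EnergyIdentity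

/-! ### The cutoff estimate for the dissipated energy -/

namespace ExtendedDissipativeSystem

variable {N : ℕ} {X : Type*} [TopologicalSpace X] (S : ExtendedDissipativeSystem N X) (u₀ : X)

theorem continuous_trajectory_eval {F : Type*} [TopologicalSpace F]
    {g : X → C(EuclideanSpace ℝ (Fin N), F)} (hg : Continuous g) :
    Continuous fun p : EuclideanSpace ℝ (Fin N) × ℝ => g (S.Φ p.2.toNNReal u₀) p.1 := by
  have h1 : Continuous fun p : EuclideanSpace ℝ (Fin N) × ℝ => S.Φ p.2.toNNReal u₀ :=
    S.Φ.continuous (continuous_real_toNNReal.comp continuous_snd) continuous_const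
  exact (hg.comp h1).eval continuous_fst

/-- Young's inequality, from `0 ≤ (√β * k - √d * |c|) ^ 2`. It serves with `c = χ x`, `k = ‖∇χ‖`,
`f` the norm of the flux and `A` the derivative of `χ` along the flux. -/
theorem neg_mul_sq_le_of_sq_le {A f d β k c : ℝ} (hd : 0 ≤ d) (hk : 0 ≤ k)
    (hβ : 0 ≤ β) (hfd : f ^ 2 ≤ β * d) (hA : |A| ≤ k * f) :
    -(β * k ^ 2) ≤ 2 * c * A + d * c ^ 2 := by
  have h1 : f ≤ √(β * d) := Real.le_sqrt_of_sq_le hfd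
  have h2 : |A| ≤ k * √(β * d) := hA.trans (by gcongr)
  rw [Real.sqrt_mul hβ] at h2
  have h3 : |c| * |A| ≤ |c| * (k * (√β * √d)) := by gcongr
  have h4 := Real.sq_sqrt hβ
  have h5 := Real.sq_sqrt hd
  have h6 : -(c * A) ≤ |c| * |A| := by rw [← abs_mul]; exact neg_le_abs _
  have h7 := sq_nonneg (√β * k - √d * |c|)
  have h8 := sq_abs c
  nlinarith

theorem dissipatedEnergy_le_of_cutoff {e₀ β : ℝ} (he₀ : ∀ x, S.e u₀ x ≤ e₀)
    (hβ : ∀ x t, S.b (S.e (S.Φ t u₀) x) ≤ β) {R T : ℝ} (hR : 0 < R) (hT : 0 < T)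
    {χ : EuclideanSpace ℝ (Fin N) → ℝ} (hχ : ContDiff ℝ ∞ χ) (hχs : HasCompactSupport χ)
    (hχ1 : ∀ x ∈ Metric.ball 0 R, χ x = 1) :
    S.dissipatedEnergy u₀ R T ≤
      e₀ * (∫ x, χ x ^ 2) + β * T * ∫ x, ‖fderiv ℝ χ x‖ ^ 2 := by
  have hβ0 : 0 ≤ β := (S.b_nonneg _ (S.e_nonneg _ 0)).trans (hβ 0 0)
  have he := S.continuous_trajectory_eval u₀ S.continuous_e
  have hf := S.continuous_trajectory_eval u₀ S.continuous_f
  have hd := S.continuous_trajectory_eval u₀ S.continuous_d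
  have hχd : Continuous (fderiv ℝ χ) := hχ.continuous_fderiv (by simp)
  have hψ : ContDiff ℝ ∞ fun x => χ x ^ 2 := hχ.pow 2
  have hψs : HasCompactSupport fun x => χ x ^ 2 := by
    refine .intro hχs fun x hx => ?_
    rw [image_eq_zero_of_notMem_tsupport hx]; simp
  have hψd : Continuous (fderiv ℝ fun x => χ x ^ 2) := hψ.continuous_fderiv (by simp)
  have hG : Integrable fun x => ‖fderiv ℝ χ x‖ ^ 2 :=
    (hχd.norm.pow 2).integrable_of_hasCompactSupport
      (.intro hχs fun x hx => by
        simp only [Pi.pow_apply]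
        rw [image_eq_zero_of_notMem_tsupport (fun h => hx (tsupport_fderiv_subset ℝ h))]
        simp)
  have hχ2 : Integrable fun x => χ x ^ 2 := hψ.continuous.integrable_of_hasCompactSupport hψs
  have id := (S.energy_balance u₀).integral_eq he hf hd hψ hψs hT
  set H : ℝ → ℝ := fun t => ∫ x, ((fderiv ℝ (fun x => χ x ^ 2) x) (S.f (S.Φ t.toNNReal u₀) x)
    + S.d (S.Φ t.toNNReal u₀) x * χ x ^ 2) with hHdef
  have hHc : Continuous H :=
    continuous_integral_of_eq_zero_off_compact
      (((hψd.comp continuous_fst).clm_apply hf).add (hd.mul (hψ.continuous.comp continuous_fst)))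
      hψs fun t x hx => by
        rw [image_eq_zero_of_notMem_tsupport hx,
          image_eq_zero_of_notMem_tsupport (fun h => hx (tsupport_fderiv_subset ℝ h))]
        simp
  have hDc : Continuous fun t : ℝ => ∫ x in Metric.ball (0 : EuclideanSpace ℝ (Fin N)) R,
      S.d (S.Φ t.toNNReal u₀) x := by
    -- Passing to the closed ball gives a compact domain, on which the parametric integral is
    -- continuous in time.
    have hae : Metric.ball (0 : EuclideanSpace ℝ (Fin N)) R =ᵐ[volume] Metric.closedBall 0 R := by
      refine ae_eq_of_subset_of_measure_ge Metric.ball_subset_closedBall (le_of_eq ?_)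
        measurableSet_ball.nullMeasurableSet measure_closedBall_lt_top.ne
      rw [Measure.addHaar_closedBall _ _ hR.le, Measure.addHaar_ball_of_pos _ _ hR]
    simp only [setIntegral_congr_set hae]
    exact continuous_parametric_integral_of_continuous
      (f := fun (t : ℝ) x => S.d (S.Φ t.toNNReal u₀) x) (hd.comp continuous_swap)
      (isCompact_closedBall _ _)
  have hpt : ∀ t : ℝ, (∫ x in Metric.ball (0 : EuclideanSpace ℝ (Fin N)) R,
      S.d (S.Φ t.toNNReal u₀) x) ≤ H t + β * ∫ x, ‖fderiv ℝ χ x‖ ^ 2 := by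
    intro t
    have hHi : Integrable fun x => (fderiv ℝ (fun x => χ x ^ 2) x) (S.f (S.Φ t.toNNReal u₀) x)
        + S.d (S.Φ t.toNNReal u₀) x * χ x ^ 2 := by
      refine Continuous.integrable_of_hasCompactSupport
        ((hψd.clm_apply (S.f _).continuous).add ((S.d _).continuous.mul hψ.continuous))
        (.intro hψs fun x hx => ?_)
      rw [image_eq_zero_of_notMem_tsupport hx,
          image_eq_zero_of_notMem_tsupport (fun h => hx (tsupport_fderiv_subset ℝ h))]
      simp
    rw [hHdef, ← integral_const_mul, ← integral_add hHi (hG.const_mul _),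
      ← integral_indicator measurableSet_ball]
    refine integral_mono_of_nonneg
      (Eventually.of_forall fun x => Set.indicator_nonneg (fun x _ => S.d_nonneg _ x) x)
      (hHi.add (hG.const_mul _)) (Eventually.of_forall fun x => ?_)
    have hfd : fderiv ℝ (fun x => χ x ^ 2) x = (2 * χ x) • fderiv ℝ χ x := by
      have := ((hχ.differentiable (by simp) x).hasFDerivAt.pow 2).fderiv
      simpa using this
    simp only [hfd, smul_apply, smul_eq_mul, Set.indicator]
    -- On the ball `∇χ = 0` and `d` is kept in full; elsewhere `d χ²` absorbs the flux.
    split_ifs with hx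
    · have : fderiv ℝ χ x = 0 := by
        have : χ =ᶠ[𝓝 x] fun _ => 1 := by
          filter_upwards [Metric.isOpen_ball.mem_nhds hx] with y hy using hχ1 y hy
        rw [this.fderiv_eq]; simp
      simp [this, hχ1 x hx]
    · have := neg_mul_sq_le_of_sq_le (c := χ x) (S.d_nonneg (S.Φ t.toNNReal u₀) x)
        (norm_nonneg (fderiv ℝ χ x)) hβ0
        ((S.flux_bound _ x).trans
          (mul_le_mul_of_nonneg_right (hβ x _) (S.d_nonneg _ x)))
        ((Real.norm_eq_abs _).symm.trans_le ((fderiv ℝ χ x).le_opNorm _))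
      linarith
  have hmono : S.dissipatedEnergy u₀ R T ≤
      ∫ t in (0 : ℝ)..T, (H t + β * ∫ x, ‖fderiv ℝ χ x‖ ^ 2) :=
    intervalIntegral.integral_mono_on hT.le (hDc.intervalIntegrable _ _)
      ((hHc.add continuous_const).intervalIntegrable _ _) fun t _ => hpt t
  rw [intervalIntegral.integral_add (hHc.intervalIntegrable _ _)
    (continuous_const.intervalIntegrable _ _), intervalIntegral.integral_const] at hmono
  have hET : 0 ≤ ∫ x, S.e (S.Φ T.toNNReal u₀) x * χ x ^ 2 :=
    integral_nonneg fun x => mul_nonneg (S.e_nonneg _ x) (sq_nonneg _)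
  have hE0 : ∫ x, S.e (S.Φ (0 : ℝ).toNNReal u₀) x * χ x ^ 2 ≤ e₀ * ∫ x, χ x ^ 2 := by
    rw [← integral_const_mul]
    refine integral_mono_of_nonneg
      (Eventually.of_forall fun x => mul_nonneg (S.e_nonneg _ x) (sq_nonneg _))
      (hχ2.const_mul _) (Eventually.of_forall fun x => ?_)
    simp only [Real.toNNReal_zero, S.Φ.map_zero_apply]
    exact mul_le_mul_of_nonneg_right (he₀ x) (sq_nonneg _)
  simp only [smul_eq_mul, sub_zero] at hmono
  linarith

end ExtendedDissipativeSystem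

/-! ### Radial integrals and radial cutoffs -/

theorem card_mul_volume_ball_eq_sphereArea {N : ℕ} (hN : 1 ≤ N) :
    N * volume.real (Metric.ball (0 : EuclideanSpace ℝ (Fin N)) 1) = sphereArea N := by
  have : Nonempty (Fin N) := ⟨⟨0, hN⟩⟩
  have hN' : (0 : ℝ) < N := by exact_mod_cast hN
  have hΓ : 0 < Real.Gamma ((N : ℝ) / 2) := Real.Gamma_pos_of_pos (by positivity)
  rw [Measure.real, EuclideanSpace.volume_ball, sphereArea, Fintype.card_fin,
    Real.Gamma_add_one (by positivity)]
  simp only [ENNReal.ofReal_one, one_pow, one_mul]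
  rw [ENNReal.toReal_ofReal (by positivity), Real.sqrt_eq_rpow, ← Real.rpow_natCast,
    ← Real.rpow_mul Real.pi_pos.le, one_div_mul_eq_div]
  field_simp

theorem volume_real_ball_eq_sphereArea {N : ℕ} (hN : 1 ≤ N) {R : ℝ} (hR : 0 < R) :
    volume.real (Metric.ball (0 : EuclideanSpace ℝ (Fin N)) R) = sphereArea N * (R ^ N / N) := by
  have hN' : (0 : ℝ) < N := by exact_mod_cast hN
  rw [Measure.real, Measure.addHaar_ball_of_pos _ _ hR, finrank_euclideanSpace, Fintype.card_fin,
    ENNReal.toReal_mul, ENNReal.toReal_ofReal (by positivity), ← Measure.real,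
    ← card_mul_volume_ball_eq_sphereArea hN]
  field_simp

theorem integrable_annulus {N : ℕ} {R L : ℝ} {w : ℝ → ℝ}
    (hw : ContinuousOn w (Set.Icc R L)) :
    Integrable fun x : EuclideanSpace ℝ (Fin N) => (Set.Icc R L).indicator w ‖x‖ := by
  have hA : IsCompact ((fun x : EuclideanSpace ℝ (Fin N) => ‖x‖) ⁻¹' Set.Icc R L) := by
    refine (isCompact_closedBall 0 L).of_isClosed_subset (isClosed_Icc.preimage continuous_norm)
      fun x hx => ?_
    simpa using hx.2
  have : (fun x : EuclideanSpace ℝ (Fin N) => (Set.Icc R L).indicator w ‖x‖) =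
      ((fun x : EuclideanSpace ℝ (Fin N) => ‖x‖) ⁻¹' Set.Icc R L).indicator fun x => w ‖x‖ := by
    ext x
    simp [Set.indicator]
  rw [this, integrable_indicator_iff hA.isClosed.measurableSet]
  exact (hw.comp continuous_norm.continuousOn fun x hx => hx).integrableOn_compact hA

theorem integral_annulus {N : ℕ} (hN : 1 ≤ N) {R L : ℝ} (hR : 0 < R) (hRL : R ≤ L)
    (w : ℝ → ℝ) :
    ∫ x : EuclideanSpace ℝ (Fin N), (Set.Icc R L).indicator w ‖x‖ =
      sphereArea N * ∫ y in R..L, y ^ (N - 1) * w y := by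
  have : Nonempty (Fin N) := ⟨⟨0, hN⟩⟩
  rw [integral_fun_norm_addHaar, finrank_euclideanSpace, Fintype.card_fin, nsmul_eq_mul,
    smul_eq_mul, ← mul_assoc, card_mul_volume_ball_eq_sphereArea hN,
    intervalIntegral.integral_of_le hRL, ← integral_Icc_eq_integral_Ioc]
  congr 1
  have h1 : (fun y : ℝ => y ^ (N - 1) • (Set.Icc R L).indicator w y) =
      (Set.Icc R L).indicator fun y => y ^ (N - 1) * w y := by
    ext y
    simp [Set.indicator]
  rw [h1, setIntegral_indicator measurableSet_Icc, Set.inter_eq_self_of_subset_right]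
  exact fun y hy => hR.trans_le hy.1

/-- A smooth compactly supported radial cutoff built from a radial profile `h`. -/
theorem exists_radial_cutoff {N : ℕ} {h : ℝ → ℝ} (hh : ContDiffOn ℝ ∞ h (Set.Ioi 0)) {R L : ℝ}
    (hR : 0 < R) (hRL : R ≤ L)
    (h1 : ∀ r, 0 < r → r ≤ R → 1 ≤ h r) (h0 : ∀ r, L ≤ r → h r ≤ 0)
    (hpos : ∀ r ∈ Set.Icc R L, 0 ≤ h r) {K : ℝ} (hK : 1 < K) :
    ∃ χ : EuclideanSpace ℝ (Fin N) → ℝ, ContDiff ℝ ∞ χ ∧ HasCompactSupport χ ∧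
      (∀ x ∈ Metric.ball 0 R, χ x = 1) ∧
      (∀ x, χ x ^ 2 ≤ (Metric.ball 0 R).indicator 1 x +
        (Set.Icc R L).indicator (fun r => K ^ 2 * h r ^ 2) ‖x‖) ∧
      ∀ x, ‖fderiv ℝ χ x‖ ^ 2 ≤
        (Set.Icc R L).indicator (fun r => K ^ 2 * deriv h r ^ 2) ‖x‖ := by
  obtain ⟨η, hη, hη0, hη1, hηd, hηK⟩ := exists_smooth_step hK
  have hηdiff : Differentiable ℝ η := hη.differentiable (by simp)
  have hηnn : ∀ s, 0 ≤ η s := fun s => by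
    rcases le_total s 0 with hs | hs
    · rw [hη0 s hs]
    · rw [← hη0 0 le_rfl]
      exact monotone_of_deriv_nonneg hηdiff hηd hs
  -- This compares the smoothed cutoff `η ∘ h` with the profile `h` itself where `h` is nonnegative.
  have hηle : ∀ s, 0 ≤ s → η s ≤ K * s := fun s hs => by
    have := image_sub_le_mul_sub_of_deriv_le hηdiff hηK hs
    rwa [hη0 0 le_rfl, sub_zero, sub_zero] at this
  -- Neither the norm nor a singular profile `h` is smooth at the origin; the value 1 there makes
  -- `χ` constant on the whole ball.
  let χ : EuclideanSpace ℝ (Fin N) → ℝ := fun x => if x = 0 then 1 else η (h ‖x‖)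
  have hχ0 : ∀ x, x ≠ 0 → χ x = η (h ‖x‖) := fun x hx => if_neg hx
  have hball : ∀ x ∈ Metric.ball (0 : EuclideanSpace ℝ (Fin N)) R, χ x = 1 := fun x hx => by
    by_cases hx0 : x = 0
    · simp [χ, hx0]
    · rw [hχ0 x hx0]
      exact hη1 _ (h1 _ (norm_pos_iff.2 hx0) (mem_ball_zero_iff.1 hx).le)
  have hout : ∀ x : EuclideanSpace ℝ (Fin N), L < ‖x‖ → χ x = 0 := fun x hx => by
    rw [hχ0 x (norm_pos_iff.1 (by linarith)), hη0 _ (h0 _ hx.le)]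
  have hev : ∀ x, x ≠ 0 → χ =ᶠ[𝓝 x] fun y => η (h ‖y‖) := fun x hx => by
    filter_upwards [isOpen_ne.mem_nhds hx] with y hy using hχ0 y hy
  have hhat : ∀ r, 0 < r → ContDiffAt ℝ ∞ h r := fun r hr =>
    (hh r hr).contDiffAt (isOpen_Ioi.mem_nhds hr)
  refine ⟨χ, ?_, ?_, hball, fun x => ?_, fun x => ?_⟩
  · rw [contDiff_iff_contDiffAt]
    intro x
    by_cases hx : x = 0
    · refine (contDiffAt_const (c := (1 : ℝ))).congr_of_eventuallyEq ?_
      filter_upwards [Metric.isOpen_ball.mem_nhds (show x ∈ Metric.ball 0 R by simpa [hx] using hR)] with y hy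
        using hball y hy
    · refine ContDiffAt.congr_of_eventuallyEq ?_ (hev x hx)
      exact hη.contDiffAt.comp x ((hhat _ (norm_pos_iff.2 hx)).comp x (contDiffAt_norm ℝ hx))
  · refine .intro (isCompact_closedBall 0 L) fun x hx => hout x ?_
    simpa using hx
  · by_cases hx : ‖x‖ < R
    · have hxb : x ∈ Metric.ball (0 : EuclideanSpace ℝ (Fin N)) R := by simpa using hx
      have hxI : ‖x‖ ∉ Set.Icc R L := fun hc => by linarith [hc.1]
      rw [hball x hxb, Set.indicator_of_mem hxb, Set.indicator_of_notMem hxI]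
      simp
    · have hxb : x ∉ Metric.ball (0 : EuclideanSpace ℝ (Fin N)) R := by simpa using hx
      rw [Set.indicator_of_notMem hxb, zero_add]
      by_cases hxL : ‖x‖ ≤ L
      · have hxI : ‖x‖ ∈ Set.Icc R L := ⟨not_lt.1 hx, hxL⟩
        rw [Set.indicator_of_mem hxI, hχ0 x (norm_pos_iff.1 (by linarith)), ← mul_pow]
        exact pow_le_pow_left₀ (hηnn _) (hηle _ (hpos _ hxI)) 2
      · rw [hout x (not_le.1 hxL), Set.indicator_of_notMem (fun hc => hxL hc.2)]
        simp
  · by_cases hxI : ‖x‖ ∈ Set.Icc R L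
    · have hx0 : x ≠ 0 := norm_pos_iff.1 (hR.trans_le hxI.1)
      rw [Set.indicator_of_mem hxI, (hev x hx0).fderiv_eq]
      have hd1 : HasDerivAt (fun r => η (h r)) (deriv η (h ‖x‖) * deriv h ‖x‖) ‖x‖ :=
        (hηdiff _).hasDerivAt.comp _
          ((hhat _ (norm_pos_iff.2 hx0)).differentiableAt (by simp)).hasDerivAt
      have hd2 : HasFDerivAt (fun x : EuclideanSpace ℝ (Fin N) => ‖x‖) (fderiv ℝ norm x) x :=
        ((contDiffAt_norm ℝ hx0 (n := 1)).differentiableAt (by simp)).hasFDerivAt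
      have hd3 : ‖fderiv ℝ (norm : EuclideanSpace ℝ (Fin N) → ℝ) x‖ ≤ 1 := by
        simpa using norm_fderiv_le_of_lipschitz ℝ (lipschitzWith_one_norm
          (E := EuclideanSpace ℝ (Fin N))) (x₀ := x)
      have hd4 : fderiv ℝ (fun y : EuclideanSpace ℝ (Fin N) => η (h ‖y‖)) x = _ :=
        (hd1.comp_hasFDerivAt x hd2).fderiv
      rw [hd4, norm_smul, Real.norm_eq_abs, mul_pow, sq_abs, mul_pow]
      have h2 : deriv η (h ‖x‖) ^ 2 ≤ K ^ 2 := pow_le_pow_left₀ (hηd _) (hηK _) 2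
      have h3 : ‖fderiv ℝ (norm : EuclideanSpace ℝ (Fin N) → ℝ) x‖ ^ 2 ≤ 1 :=
        pow_le_one₀ (norm_nonneg _) hd3
      calc _ ≤ K ^ 2 * deriv h ‖x‖ ^ 2 * 1 := by gcongr
        _ = _ := mul_one _
    · have : ∃ c, χ =ᶠ[𝓝 x] fun _ => c := by
        rcases lt_or_ge ‖x‖ R with hx | hx
        · refine ⟨1, ?_⟩
          filter_upwards [Metric.isOpen_ball.mem_nhds (mem_ball_zero_iff.2 hx)] with y hy
            using hball y hy
        · have hxL : L < ‖x‖ := by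
            by_contra hc
            exact hxI ⟨hx, not_lt.1 hc⟩
          refine ⟨0, ?_⟩
          filter_upwards [(isOpen_Ioi.preimage continuous_norm).mem_nhds hxL] with y hy
            using hout y hy
      obtain ⟨c, hc⟩ := this
      rw [hc.fderiv_eq, Set.indicator_of_notMem hxI]
      simp

/-! ### Dissipation bounds from one-dimensional profiles -/

namespace ExtendedDissipativeSystem

variable {N : ℕ} {X : Type*} [TopologicalSpace X] (S : ExtendedDissipativeSystem N X) (u₀ : X)

/-- The cutoff bound in polar coordinates. The left side does not depend on the smoothing parameter
`K`, so `K → 1` removes it from the right side. -/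
theorem dissipatedEnergy_le_of_radial {e₀ β : ℝ} (he₀ : ∀ x, S.e u₀ x ≤ e₀)
    (hβ : ∀ x t, S.b (S.e (S.Φ t u₀) x) ≤ β) {R L T : ℝ} (hN : 1 ≤ N) (hR : 0 < R) (hRL : R ≤ L)
    (hT : 0 < T) {h : ℝ → ℝ} (hh : ContDiffOn ℝ ∞ h (Set.Ioi 0))
    (h1 : ∀ r, 0 < r → r ≤ R → 1 ≤ h r) (h0 : ∀ r, L ≤ r → h r ≤ 0)
    (hpos : ∀ r ∈ Set.Icc R L, 0 ≤ h r) :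
    S.dissipatedEnergy u₀ R T ≤ sphereArea N *
      (e₀ * (R ^ N / N + ∫ y in R..L, y ^ (N - 1) * h y ^ 2) +
        β * T * ∫ y in R..L, y ^ (N - 1) * deriv h y ^ 2) := by
  have hβ0 : 0 ≤ β := (S.b_nonneg _ (S.e_nonneg _ 0)).trans (hβ 0 0)
  have he0 : 0 ≤ e₀ := (S.e_nonneg _ 0).trans (he₀ 0)
  have hIcc : Set.Icc R L ⊆ Set.Ioi 0 := fun r hr => hR.trans_le hr.1
  have hhc : ContinuousOn h (Set.Icc R L) := hh.continuousOn.mono hIcc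
  have hdc : ContinuousOn (deriv h) (Set.Icc R L) :=
    (hh.continuousOn_deriv_of_isOpen isOpen_Ioi (by simp)).mono hIcc
  have hK : ∀ K : ℝ, 1 < K → S.dissipatedEnergy u₀ R T ≤ sphereArea N *
      (e₀ * (R ^ N / N + K ^ 2 * ∫ y in R..L, y ^ (N - 1) * h y ^ 2) +
        β * T * (K ^ 2 * ∫ y in R..L, y ^ (N - 1) * deriv h y ^ 2)) := by
    intro K hK
    obtain ⟨χ, hχ, hχs, hχ1, hχv, hχw⟩ := exists_radial_cutoff (N := N) hh hR hRL h1 h0 hpos hK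
    have hv : Integrable fun x : EuclideanSpace ℝ (Fin N) =>
        (Set.Icc R L).indicator (fun r => K ^ 2 * h r ^ 2) ‖x‖ :=
      integrable_annulus (by fun_prop)
    have hw : Integrable fun x : EuclideanSpace ℝ (Fin N) =>
        (Set.Icc R L).indicator (fun r => K ^ 2 * deriv h r ^ 2) ‖x‖ :=
      integrable_annulus (by fun_prop)
    have hb : Integrable ((Metric.ball (0 : EuclideanSpace ℝ (Fin N)) R).indicator
        (1 : EuclideanSpace ℝ (Fin N) → ℝ)) :=
      (integrable_indicator_iff measurableSet_ball).2
        (integrableOn_const measure_ball_lt_top.ne)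
    have hmul : ∀ g : ℝ → ℝ, ∫ y in R..L, y ^ (N - 1) * (K ^ 2 * g y ^ 2) =
        K ^ 2 * ∫ y in R..L, y ^ (N - 1) * g y ^ 2 := fun g => by
      rw [← intervalIntegral.integral_const_mul]
      congr 1
      ext y
      ring
    have hI1 : ∫ x, χ x ^ 2 ≤ sphereArea N *
        (R ^ N / N + K ^ 2 * ∫ y in R..L, y ^ (N - 1) * h y ^ 2) := by
      refine (integral_mono_of_nonneg (Eventually.of_forall fun x => sq_nonneg _) (hb.add hv)
        (Eventually.of_forall hχv)).trans_eq ?_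
      rw [integral_add' hb hv, integral_annulus hN hR hRL, integral_indicator_one measurableSet_ball,
        volume_real_ball_eq_sphereArea hN hR, hmul]
      ring
    have hI2 : ∫ x, ‖fderiv ℝ χ x‖ ^ 2 ≤ sphereArea N *
        (K ^ 2 * ∫ y in R..L, y ^ (N - 1) * deriv h y ^ 2) := by
      refine (integral_mono_of_nonneg (Eventually.of_forall fun x => sq_nonneg _) hw
        (Eventually.of_forall hχw)).trans_eq ?_
      rw [integral_annulus hN hR hRL, hmul]
    calc _ ≤ _ := S.dissipatedEnergy_le_of_cutoff u₀ he₀ hβ hR hT hχ hχs hχ1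
      _ ≤ e₀ * (sphereArea N *
        (R ^ N / N + K ^ 2 * ∫ y in R..L, y ^ (N - 1) * h y ^ 2)) + β * T * (sphereArea N *
        (K ^ 2 * ∫ y in R..L, y ^ (N - 1) * deriv h y ^ 2)) := by gcongr
      _ = _ := by ring
  have hcont : Continuous fun K : ℝ => sphereArea N *
      (e₀ * (R ^ N / N + K ^ 2 * ∫ y in R..L, y ^ (N - 1) * h y ^ 2) +
        β * T * (K ^ 2 * ∫ y in R..L, y ^ (N - 1) * deriv h y ^ 2)) := by fun_prop
  have hlim := (hcont.tendsto 1).mono_left (nhdsWithin_le_nhds (s := Set.Ioi 1))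
  simp only [one_pow, one_mul] at hlim
  refine ge_of_tendsto hlim ?_
  filter_upwards [self_mem_nhdsWithin] with K hK1 using hK K hK1

/-- The capacitary estimate: `P` is a primitive of `r ^ (1 - N)`. -/
theorem dissipatedEnergy_le_of_primitive {e₀ β : ℝ} (he₀ : ∀ x, S.e u₀ x ≤ e₀)
    (hβ : ∀ x t, S.b (S.e (S.Φ t u₀) x) ≤ β) {R L T : ℝ} (hN : 1 ≤ N) (hR : 0 < R) (hRL : R < L)
    (hT : 0 < T) {P : ℝ → ℝ} (hP : ContDiffOn ℝ ∞ P (Set.Ioi 0))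
    (hP' : ∀ r, 0 < r → HasDerivAt P (r ^ (N - 1))⁻¹ r) :
    S.dissipatedEnergy u₀ R T ≤ sphereArea N * (e₀ * (L ^ N / N) + β * T / (P L - P R)) := by
  have hβ0 : 0 ≤ β := (S.b_nonneg _ (S.e_nonneg _ 0)).trans (hβ 0 0)
  have he0 : 0 ≤ e₀ := (S.e_nonneg _ 0).trans (he₀ 0)
  have hN' : (0 : ℝ) < N := by exact_mod_cast hN
  have hω : 0 ≤ sphereArea N := by
    rw [← card_mul_volume_ball_eq_sphereArea hN]; positivity
  have hmono : StrictMonoOn P (Set.Ioi 0) := by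
    refine strictMonoOn_of_deriv_pos (convex_Ioi 0) hP.continuousOn fun r hr => ?_
    rw [interior_Ioi] at hr
    rw [(hP' r hr).deriv]
    have : (0 : ℝ) < r := hr
    positivity
  have hL : 0 < L := hR.trans hRL
  -- Dividing by `A` normalizes the profile `P L - P r` to be 1 at `R` and 0 at `L`.
  set A := P L - P R with hA
  have hA0 : 0 < A := sub_pos.2 (hmono hR hL hRL)
  have hd : ∀ r, 0 < r → HasDerivAt (fun r => (P L - P r) / A) (-(r ^ (N - 1))⁻¹ / A) r :=
    fun r hr => ((hP' r hr).const_sub _).div_const _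
  have hh : ContDiffOn ℝ ∞ (fun r => (P L - P r) / A) (Set.Ioi 0) :=
    (contDiffOn_const.sub hP).div_const _
  have hbd : ∀ r ∈ Set.Icc R L, 0 ≤ (P L - P r) / A ∧ (P L - P r) / A ≤ 1 := fun r hr => by
    have hr0 : 0 < r := hR.trans_le hr.1
    have h1 := hmono.monotoneOn hR hr0 hr.1
    have h2 := hmono.monotoneOn hr0 hL hr.2
    exact ⟨div_nonneg (by linarith) hA0.le, (div_le_one hA0).2 (by linarith)⟩
  have key := S.dissipatedEnergy_le_of_radial u₀ he₀ hβ hN hR hRL.le hT hh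
    (fun r hr hrR => (one_le_div hA0).2 (by linarith [hmono.monotoneOn hr hR hrR]))
    (fun r hr => div_nonpos_of_nonpos_of_nonneg
      (by linarith [hmono.monotoneOn hL (hL.trans_le hr) hr]) hA0.le)
    (fun r hr => (hbd r hr).1)
  have hinvc : ContinuousOn (fun y : ℝ => (y ^ (N - 1))⁻¹) (Set.uIcc R L) := by
    rw [Set.uIcc_of_le hRL.le]
    exact (continuous_pow _).continuousOn.inv₀ fun y hy =>
      (pow_pos (hR.trans_le hy.1) _).ne'
  -- The crude bound by 1 on the profile suffices, the initial energy being of lower order for the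
  -- chosen `L`.
  have hI1 : ∫ y in R..L, y ^ (N - 1) * ((P L - P y) / A) ^ 2 ≤ (L ^ N - R ^ N) / N := by
    have : ∫ y in R..L, y ^ (N - 1) = (L ^ N - R ^ N) / N := by
      rw [integral_pow]
      have : N - 1 + 1 = N := by omega
      rw [this]
      congr 1
      rw [← Nat.cast_add_one, this]
    rw [← this]
    refine intervalIntegral.integral_mono_on hRL.le ?_
      ((continuous_pow _).intervalIntegrable _ _) fun y hy => ?_
    · refine ContinuousOn.intervalIntegrable ?_
      rw [Set.uIcc_of_le hRL.le]
      exact (continuous_pow _).continuousOn.mul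
        ((hh.continuousOn.mono fun r hr => hR.trans_le hr.1).pow 2)
    · have hy0 : 0 < y := hR.trans_le hy.1
      exact mul_le_of_le_one_right (by positivity) (pow_le_one₀ (hbd y hy).1 (hbd y hy).2)
  -- The integrand is `P' / A ^ 2`, and `P` increases by `A` over `[R, L]`.
  have hI2 : ∫ y in R..L, y ^ (N - 1) * deriv (fun r => (P L - P r) / A) y ^ 2 = 1 / A := by
    have h1 : ∫ y in R..L, y ^ (N - 1) * deriv (fun r => (P L - P r) / A) y ^ 2 =
        ∫ y in R..L, (y ^ (N - 1))⁻¹ / A ^ 2 := by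
      refine intervalIntegral.integral_congr fun y hy => ?_
      rw [Set.uIcc_of_le hRL.le] at hy
      have hy0 : 0 < y := hR.trans_le hy.1
      simp only [(hd y hy0).deriv]
      field_simp
    rw [h1, intervalIntegral.integral_div, intervalIntegral.integral_eq_sub_of_hasDerivAt
      (f := P) (fun y hy => ?_) hinvc.intervalIntegrable, ← hA]
    · field_simp
    · rw [Set.uIcc_of_le hRL.le] at hy
      exact hP' y (hR.trans_le hy.1)
  rw [hI2] at key
  refine key.trans ?_
  have : e₀ * (R ^ N / N + ∫ y in R..L, y ^ (N - 1) * ((P L - P y) / A) ^ 2) ≤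
      e₀ * (L ^ N / N) := by
    refine mul_le_mul_of_nonneg_left ?_ he0
    rw [sub_div] at hI1
    linarith
  refine mul_le_mul_of_nonneg_left ?_ hω
  rw [mul_one_div]
  linarith

end ExtendedDissipativeSystem

/-! ### Sphere areas and upper limits in the extended reals -/

theorem sphereArea_one : sphereArea 1 = 2 := by
  have h : √Real.pi ≠ 0 := (Real.sqrt_pos.2 Real.pi_pos).ne'
  simp only [sphereArea, Nat.cast_one]
  rw [Real.Gamma_one_half_eq, ← Real.sqrt_eq_rpow, mul_div_assoc, div_self h, mul_one]

theorem sphereArea_two : sphereArea 2 = 2 * Real.pi := by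
  simp [sphereArea]

theorem EReal.limsup_le_of_le_of_tendsto {u v : ℝ → ℝ} {l : ℝ} (huv : ∀ᶠ T in atTop, u T ≤ v T)
    (hv : Tendsto v atTop (𝓝 l)) : limsup (fun T => (u T : EReal)) atTop ≤ (l : EReal) := by
  have hv' : Tendsto (fun T => (v T : EReal)) atTop (𝓝 (l : EReal)) :=
    (continuous_coe_real_ereal.tendsto l).comp hv
  rw [← hv'.limsup_eq]
  exact limsup_le_limsup (huv.mono fun T hT => EReal.coe_le_coe_iff.2 hT)

theorem EReal.le_coe_of_tendsto {ι : Type*} {F : Filter ι} [F.NeBot] {a : EReal} {v : ι → ℝ}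
    {l : ℝ} (ha : ∀ᶠ i in F, a ≤ (v i : EReal)) (hv : Tendsto v F (𝓝 l)) : a ≤ (l : EReal) :=
  ge_of_tendsto ((continuous_coe_real_ereal.tendsto l).comp hv) ha

namespace ExtendedDissipativeSystem

variable {N : ℕ} {X : Type*} [TopologicalSpace X]

/-! ### Dimension one -/

/-- The profile is `exp (-c (r - R))`, the decaying solution of the Euler-Lagrange equation `h'' =
c² h`. It is truncated at `L` by subtracting its value `δ` there and rescaling; then `L → ∞`. -/
theorem dissipatedEnergy_le_of_decay_rate (S : ExtendedDissipativeSystem 1 X) (u₀ : X) {e₀ β : ℝ}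
    (he₀ : ∀ x, S.e u₀ x ≤ e₀) (hβ : ∀ x t, S.b (S.e (S.Φ t u₀) x) ≤ β) {R T c : ℝ} (hR : 0 < R)
    (hT : 0 < T) (hc : 0 < c) :
    S.dissipatedEnergy u₀ R T ≤ e₀ * (2 * R + 1 / c) + β * T * c := by
  have hβ0 : 0 ≤ β := (S.b_nonneg _ (S.e_nonneg _ 0)).trans (hβ 0 0)
  have he0 : 0 ≤ e₀ := (S.e_nonneg _ 0).trans (he₀ 0)
  have hL : ∀ L, R < L → S.dissipatedEnergy u₀ R T ≤
      2 * (e₀ * (R + 1 / (2 * c) / (1 - Real.exp (-c * (L - R))) ^ 2) +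
        β * T * (c / 2 / (1 - Real.exp (-c * (L - R))) ^ 2)) := by
    intro L hRL
    set δ := Real.exp (-c * (L - R)) with hδ
    have hδ1 : δ < 1 := Real.exp_lt_one_iff.2 (by nlinarith)
    have hδ0 : 0 < δ := Real.exp_pos _
    have hδ2 : 0 < 1 - δ := by linarith
    set g : ℝ → ℝ := fun r => Real.exp (-c * (r - R)) with hg
    have hgmono : ∀ {r s}, r ≤ s → g s ≤ g r := fun {r s} hrs => Real.exp_le_exp.2 (by nlinarith)
    have hgR : g R = 1 := by simp [hg]
    have hgd : ∀ r, HasDerivAt g (-c * g r) r := fun r => by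
      have := (((hasDerivAt_id r).sub_const R).const_mul (-c)).exp
      simpa [hg, mul_comm] using this
    have hgc : Continuous g := by fun_prop
    have hd : ∀ r, HasDerivAt (fun r => (g r - δ) / (1 - δ)) (-c * g r / (1 - δ)) r := fun r =>
      ((hgd r).sub_const _).div_const _
    have key := S.dissipatedEnergy_le_of_radial u₀ he₀ hβ le_rfl hR hRL.le hT
      (h := fun r => (g r - δ) / (1 - δ)) (by fun_prop)
      (fun r _ hr => (one_le_div hδ2).2 (by linarith [hgmono hr]))
      (fun r hr => div_nonpos_of_nonpos_of_nonneg (by linarith [show g r ≤ δ from hgmono hr])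
        hδ2.le)
      (fun r hr => div_nonneg (by linarith [show δ ≤ g r from hgmono hr.2]) hδ2.le)
    have hq : ∫ y in R..L, g y ^ 2 ≤ 1 / (2 * c) := by
      have hpr : ∀ y ∈ Set.uIcc R L, HasDerivAt (fun y => -(g y ^ 2) / (2 * c)) (g y ^ 2) y :=
        fun y _ => by
          convert! ((hgd y).pow 2).neg.div_const (2 * c) using 1
          field_simp
          simp
          ring
      rw [intervalIntegral.integral_eq_sub_of_hasDerivAt hpr ((hgc.pow 2).intervalIntegrable _ _),
        hgR]
      have : 0 ≤ g L ^ 2 / (2 * c) := by positivity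
      rw [neg_div, neg_div]
      simp only [one_pow]
      linarith
    have hI1 : ∫ y in R..L, y ^ (1 - 1) * ((g y - δ) / (1 - δ)) ^ 2 ≤
        1 / (2 * c) / (1 - δ) ^ 2 := by
      calc _ ≤ ∫ y in R..L, g y ^ 2 / (1 - δ) ^ 2 := by
            refine intervalIntegral.integral_mono_on hRL.le ?_ ?_ fun y hy => ?_
            · exact Continuous.intervalIntegrable (by fun_prop) _ _
            · exact Continuous.intervalIntegrable (by fun_prop) _ _
            · have h1 : δ ≤ g y := hgmono hy.2
              rw [div_pow, Nat.sub_self, pow_zero, one_mul]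
              gcongr
              linarith
        _ = (∫ y in R..L, g y ^ 2) / (1 - δ) ^ 2 := intervalIntegral.integral_div _ _
        _ ≤ _ := by gcongr
    have hI2 : ∫ y in R..L, y ^ (1 - 1) * deriv (fun r => (g r - δ) / (1 - δ)) y ^ 2 ≤
        c / 2 / (1 - δ) ^ 2 := by
      calc _ = ∫ y in R..L, c ^ 2 / (1 - δ) ^ 2 * g y ^ 2 := by
            congr 1
            ext y
            rw [(hd y).deriv, Nat.sub_self, pow_zero, div_pow]
            ring
        _ = c ^ 2 / (1 - δ) ^ 2 * ∫ y in R..L, g y ^ 2 := intervalIntegral.integral_const_mul _ _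
        _ ≤ c ^ 2 / (1 - δ) ^ 2 * (1 / (2 * c)) := by gcongr
        _ = _ := by field_simp
    rw [sphereArea_one, pow_one, Nat.cast_one, div_one] at key
    refine key.trans ?_
    gcongr
  have hδ : Tendsto (fun L => Real.exp (-c * (L - R))) atTop (𝓝 0) :=
    Real.tendsto_exp_atBot.comp
      ((tendsto_atTop_add_const_right _ (-R) tendsto_id).const_mul_atTop_of_neg (neg_lt_zero.2 hc))
  have hlim : Tendsto (fun L => 2 * (e₀ * (R + 1 / (2 * c) / (1 - Real.exp (-c * (L - R))) ^ 2) +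
      β * T * (c / 2 / (1 - Real.exp (-c * (L - R))) ^ 2))) atTop
      (𝓝 (2 * (e₀ * (R + 1 / (2 * c) / (1 - 0) ^ 2) + β * T * (c / 2 / (1 - 0) ^ 2)))) := by
    have h1 : Tendsto (fun L => (1 - Real.exp (-c * (L - R))) ^ 2) atTop (𝓝 ((1 - 0) ^ 2)) :=
      (hδ.const_sub 1).pow 2
    exact (((tendsto_const_nhds.div h1 (by norm_num)).const_add R |>.const_mul e₀).add
      ((tendsto_const_nhds.div h1 (by norm_num)).const_mul (β * T))).const_mul 2
  refine (ge_of_tendsto hlim ((eventually_gt_atTop R).mono hL)).trans_eq ?_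
  field_simp
  ring

theorem limsup_dissipatedEnergy_one (S : ExtendedDissipativeSystem 1 X) (u₀ : X) {e₀ β : ℝ}
    (he₀ : ∀ x, S.e u₀ x ≤ e₀) (hβ : ∀ x t, S.b (S.e (S.Φ t u₀) x) ≤ β) {R : ℝ} (hR : 0 < R) :
    limsup (fun T : ℝ => ((1 / √T * S.dissipatedEnergy u₀ R T : ℝ) : EReal)) atTop
      ≤ ((2 * √(β * e₀) : ℝ) : EReal) := by
  have hβ0 : 0 ≤ β := (S.b_nonneg _ (S.e_nonneg _ 0)).trans (hβ 0 0)
  have he0 : 0 ≤ e₀ := (S.e_nonneg _ 0).trans (he₀ 0)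
  have hk : ∀ k : ℝ, 0 < k →
      limsup (fun T : ℝ => ((1 / √T * S.dissipatedEnergy u₀ R T : ℝ) : EReal)) atTop
        ≤ ((e₀ / k + β * k : ℝ) : EReal) := by
    intro k hk
    refine EReal.limsup_le_of_le_of_tendsto (v := fun T => e₀ * (2 * R) / √T + (e₀ / k + β * k))
      ?_ ?_
    · filter_upwards [eventually_gt_atTop 0] with T hT
      have hs : 0 < √T := Real.sqrt_pos.2 hT
      -- With `c = k / √T` both main terms grow like `√T`.
      have := S.dissipatedEnergy_le_of_decay_rate u₀ he₀ hβ hR hT (div_pos hk hs)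
      calc _ ≤ 1 / √T * (e₀ * (2 * R + 1 / (k / √T)) + β * T * (k / √T)) := by gcongr
        _ = _ := by
          have h2 : T = √T ^ 2 := (Real.sq_sqrt hT.le).symm
          set s := √T
          rw [h2]
          field_simp
          ring
    · have := (Real.tendsto_sqrt_atTop.const_div_atTop (e₀ * (2 * R))).add_const (e₀ / k + β * k)
      simpa using this
  -- The optimal `k` is `√e₀ / √β`; adding `ε` to both covers the cases where `e₀` or `β` vanishes.
  have hε : ∀ ε : ℝ, 0 < ε →
      limsup (fun T : ℝ => ((1 / √T * S.dissipatedEnergy u₀ R T : ℝ) : EReal)) atTop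
        ≤ ((2 * √((β + ε) * (e₀ + ε)) : ℝ) : EReal) := by
    intro ε hε
    have hA : 0 < √(e₀ + ε) := Real.sqrt_pos.2 (by linarith)
    have hB : 0 < √(β + ε) := Real.sqrt_pos.2 (by linarith)
    have hA2 := Real.sq_sqrt (show 0 ≤ e₀ + ε by linarith)
    have hB2 := Real.sq_sqrt (show 0 ≤ β + ε by linarith)
    refine (hk _ (div_pos hA hB)).trans (EReal.coe_le_coe_iff.2 ?_)
    rw [Real.sqrt_mul (by linarith)]
    set A := √(e₀ + ε)
    set B := √(β + ε)
    calc e₀ / (A / B) + β * (A / B) ≤ A ^ 2 / (A / B) + B ^ 2 * (A / B) := by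
          gcongr <;> linarith
      _ = _ := by field_simp; ring
  have hcont : Continuous fun ε : ℝ => 2 * √((β + ε) * (e₀ + ε)) := by fun_prop
  have hlim := (hcont.tendsto 0).mono_left (nhdsWithin_le_nhds (s := Set.Ioi 0))
  simp only [add_zero] at hlim
  refine EReal.le_coe_of_tendsto ?_ hlim
  filter_upwards [self_mem_nhdsWithin] with ε h using hε ε h

/-! ### Dimension two -/

theorem limsup_dissipatedEnergy_two (S : ExtendedDissipativeSystem 2 X) (u₀ : X) {e₀ β : ℝ}
    (he₀ : ∀ x, S.e u₀ x ≤ e₀) (hβ : ∀ x t, S.b (S.e (S.Φ t u₀) x) ≤ β) {R : ℝ} (hR : 0 < R) :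
    limsup (fun T : ℝ => ((Real.log T / T * S.dissipatedEnergy u₀ R T : ℝ) : EReal)) atTop
      ≤ ((4 * Real.pi * β : ℝ) : EReal) := by
  have hq : Tendsto (fun s : ℝ => 1 / 2 - Real.log s / s - Real.log R / s) atTop
      (𝓝 (1 / 2 - 0 - 0)) :=
    (tendsto_const_nhds.sub Real.isLittleO_log_id_atTop.tendsto_div_nhds_zero).sub
      (tendsto_const_nhds.div_atTop tendsto_id)
  have hq' := hq.comp Real.tendsto_log_atTop
  refine EReal.limsup_le_of_le_of_tendsto (v := fun T => 2 * Real.pi * (e₀ / 2 / Real.log T +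
    β / (1 / 2 - Real.log (Real.log T) / Real.log T - Real.log R / Real.log T))) ?_ ?_
  · filter_upwards [eventually_gt_atTop 1, hq'.eventually_const_lt (u := 0) (by norm_num)]
      with T hT hpos
    have hT0 : 0 < T := by linarith
    have hs : 0 < Real.log T := Real.log_pos hT
    simp only [Function.comp_apply] at hpos
    -- The choice `L = √T / log T` makes `L² log T / T` tend to 0 while `log L` stays equivalent to
    -- `(log T) / 2`, whence the constant `2π · 2β`.
    have hL0 : 0 < √T / Real.log T := div_pos (Real.sqrt_pos.2 hT0) hs
    have hlogL : Real.log (√T / Real.log T) - Real.log R = Real.log T *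
        (1 / 2 - Real.log (Real.log T) / Real.log T - Real.log R / Real.log T) := by
      rw [Real.log_div (Real.sqrt_pos.2 hT0).ne' hs.ne', Real.log_sqrt hT0.le]
      field_simp
    have hRL : R < √T / Real.log T := by
      rw [← Real.log_lt_log_iff hR hL0, ← sub_pos, hlogL]
      positivity
    have key := S.dissipatedEnergy_le_of_primitive u₀ he₀ hβ one_le_two hR hRL hT0 (P := Real.log)
      (Real.contDiffOn_log.mono fun r hr => ne_of_gt hr)
      (fun r hr => by simpa using Real.hasDerivAt_log hr.ne')
    rw [hlogL, sphereArea_two, div_pow, Real.sq_sqrt hT0.le] at key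
    set q := 1 / 2 - Real.log (Real.log T) / Real.log T - Real.log R / Real.log T
    calc _ ≤ Real.log T / T * (2 * Real.pi * (e₀ * (T / Real.log T ^ 2 / (2 : ℕ)) +
          β * T / (Real.log T * q))) := by gcongr
      _ = _ := by push_cast; field_simp
  · have h1 : Tendsto (fun T => e₀ / 2 / Real.log T) atTop (𝓝 0) :=
      tendsto_const_nhds.div_atTop Real.tendsto_log_atTop
    have h2 := (h1.add ((tendsto_const_nhds (x := β)).div hq' (by norm_num))).const_mul (2 * Real.pi)
    have h3 : 2 * Real.pi * (0 + β / (1 / 2 - 0 - 0)) = 4 * Real.pi * β := by ring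
    rw [h3] at h2
    exact h2

/-! ### Higher dimensions -/

theorem limsup_dissipatedEnergy_of_three_le (S : ExtendedDissipativeSystem N X) (u₀ : X)
    {e₀ β : ℝ} (he₀ : ∀ x, S.e u₀ x ≤ e₀) (hβ : ∀ x t, S.b (S.e (S.Φ t u₀) x) ≤ β) {R : ℝ}
    (hR : 0 < R) (hN : 3 ≤ N) :
    limsup (fun T : ℝ => ((1 / T * S.dissipatedEnergy u₀ R T : ℝ) : EReal)) atTop
      ≤ ((β * ((N : ℝ) - 2) * sphereArea N * R ^ (N - 2) : ℝ) : EReal) := by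
  obtain ⟨n, rfl⟩ : ∃ n, N = n + 1 + 2 := ⟨N - 3, by omega⟩
  simp only [Nat.add_sub_cancel]
  have hn : (0 : ℝ) < (n : ℝ) + 1 := by positivity
  -- Here `n + 1 = N - 2`. This primitive of `r ^ (1 - N)` vanishes at infinity, so the capacity
  -- stays positive as `L → ∞`.
  set P : ℝ → ℝ := fun r => -(r ^ (n + 1))⁻¹ / (n + 1) with hPdef
  have hPd : ∀ r, 0 < r → HasDerivAt P (r ^ (n + 1 + 2 - 1))⁻¹ r := fun r hr => by
    have h := ((hasDerivAt_pow (n + 1) r).inv (pow_pos hr _).ne').neg.div_const ((n : ℝ) + 1)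
    convert! h using 1
    have : n + 1 + 2 - 1 = n + 2 := by omega
    rw [this]
    push_cast
    field_simp
    ring
  have hPc : ContDiffOn ℝ ∞ P (Set.Ioi 0) :=
    (ContDiffOn.inv (f := fun r : ℝ => r ^ (n + 1)) (by fun_prop)
      fun r hr => (pow_pos (Set.mem_Ioi.1 hr) _).ne').neg.div_const _
  have hL : ∀ L, R < L →
      limsup (fun T : ℝ => ((1 / T * S.dissipatedEnergy u₀ R T : ℝ) : EReal)) atTop
        ≤ ((sphereArea (n + 1 + 2) * (0 + β / (P L - P R)) : ℝ) : EReal) := by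
    -- For fixed `L` the initial energy term is constant in `T` and disappears after division by
    -- `T`.
    intro L hRL
    refine EReal.limsup_le_of_le_of_tendsto (v := fun T => sphereArea (n + 1 + 2) *
      (e₀ * (L ^ (n + 1 + 2) / (n + 1 + 2 : ℕ)) / T + β / (P L - P R))) ?_ ?_
    · filter_upwards [eventually_gt_atTop 0] with T hT
      have key := S.dissipatedEnergy_le_of_primitive u₀ he₀ hβ (by omega) hR hRL hT hPc hPd
      calc _ ≤ 1 / T * (sphereArea (n + 1 + 2) * (e₀ * (L ^ (n + 1 + 2) / (n + 1 + 2 : ℕ)) +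
            β * T / (P L - P R))) := by gcongr
        _ = _ := by
          field_simp
    · exact ((tendsto_const_nhds.div_atTop tendsto_id).add_const _).const_mul _
  have hPL : Tendsto P atTop (𝓝 0) := by
    have := ((tendsto_pow_atTop (α := ℝ) (n := n + 1) (by omega)).inv_tendsto_atTop.neg).div_const
      ((n : ℝ) + 1)
    simpa [hPdef] using this
  have hPR : P R ≠ 0 := by
    simp only [hPdef]
    exact div_ne_zero (neg_ne_zero.2 (inv_ne_zero (pow_pos hR _).ne')) hn.ne'
  have hlim : Tendsto (fun L => sphereArea (n + 1 + 2) * (0 + β / (P L - P R))) atTop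
      (𝓝 (sphereArea (n + 1 + 2) * (0 + β / (0 - P R)))) :=
    (((tendsto_const_nhds (x := β)).div (hPL.sub_const _) (by simpa using hPR)).const_add 0).const_mul _
  have hval : sphereArea (n + 1 + 2) * (0 + β / (0 - P R)) =
      β * (((n + 1 + 2 : ℕ) : ℝ) - 2) * sphereArea (n + 1 + 2) * R ^ (n + 1) := by
    have hRn : R ^ (n + 1) ≠ 0 := (pow_pos hR _).ne'
    simp only [hPdef]
    push_cast
    field_simp
    ring
  rw [← hval]
  exact EReal.le_coe_of_tendsto ((eventually_gt_atTop R).mono hL) hlim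

end ExtendedDissipativeSystem

/-- The upper limits are taken in the extended reals. -/
theorem corollary4p1 {N : ℕ} {X : Type*} [TopologicalSpace X]
    [TopologicalSpace.MetrizableSpace X] (S : ExtendedDissipativeSystem N X) (u₀ : X) (e₀ β : ℝ)
    (he₀ : IsLUB (Set.range fun x : EuclideanSpace ℝ (Fin N) => S.e u₀ x) e₀)
    (hβ : IsLUB (Set.range fun p : EuclideanSpace ℝ (Fin N) × ℝ≥0 =>
      S.b (S.e (S.Φ p.2 u₀) p.1)) β)
    (R : ℝ) (hR : 0 < R) :
    (N = 1 →
      limsup (fun T : ℝ => ((1 / √T * S.dissipatedEnergy u₀ R T : ℝ) : EReal)) atTop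
        ≤ ((2 * √(β * e₀) : ℝ) : EReal)) ∧
    (N = 2 → 0 < e₀ → 0 < β →
      limsup (fun T : ℝ => ((Real.log T / T * S.dissipatedEnergy u₀ R T : ℝ) : EReal)) atTop
        ≤ ((4 * Real.pi * β : ℝ) : EReal)) ∧
    (3 ≤ N → 0 < e₀ → 0 < β →
      limsup (fun T : ℝ => ((1 / T * S.dissipatedEnergy u₀ R T : ℝ) : EReal)) atTop
        ≤ ((β * ((N : ℝ) - 2) * sphereArea N * R ^ (N - 2) : ℝ) : EReal)) := by
  have he : ∀ x, S.e u₀ x ≤ e₀ := fun x => he₀.1 ⟨x, rfl⟩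
  have hb : ∀ x t, S.b (S.e (S.Φ t u₀) x) ≤ β := fun x t => hβ.1 ⟨(x, t), rfl⟩
  refine ⟨?_, ?_, fun hN _ _ => S.limsup_dissipatedEnergy_of_three_le u₀ he hb hR hN⟩
  · rintro rfl
    exact S.limsup_dissipatedEnergy_one u₀ he hb hR
  · rintro rfl _ _
    exact S.limsup_dissipatedEnergy_two u₀ he hb hR
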